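/- Let $Z, W$ be i.i.d. random variables with values in the positive integers $\{1,2,3,\dots\}$, and let $(Z_n)_{n\ge 1}$ and $(W_n)_{n\ge 1}$ be jointly independent random variables, all with the same law as $Z$. Consider the random directed graph with vertex set $\mathbb{Z}$ in which every $n\ge 1$ has outgoing edges to $n-Z_n$ and $n-W_n$, and the vertices $n\le 0$ (the leaves) have no outgoing edge. Let $T_n$ be the set of vertices reached from $n$, that is, $T_n=\{n\}$ for $n\le 0$ and $T_n=\{n\}\cup T_{n-Z_n}\cup T_{n-W_n}$ for $n\ge 1$, and let $\Lambda_n=\left|T_n\cap\{0,-1,-2,\dots\}\right|$ be the number of leaves reached from $n$. Assume that the law of $Z$ is aperiodic, i.e. the greatest common divisor of the support $\{k\ge 1:\mathbb{P}(Z=k)>0\}$ is $1$, and that $\mathbb{E} Z=\infty$ and $\mathbb{E}\min(Z,W)<\infty$ (the moderate-tail regime). Then $$\Lambda_n\to\infty\quad\text{almost surely as } n\to\infty .$$ (When the leaves carry i.i.d. uniform preference values, this property is, by definition, the strong consistency of the two-choice recommendation system.) -/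

import Mathlib

open MeasureTheory ProbabilityTheory Filter
open scoped ENNReal

namespace TwoChoice

/-- The positive integers carry the discrete σ-algebra. -/
instance instMeasurableSpacePNat : MeasurableSpace ℕ+ := ⊤

instance instDiscreteMeasurableSpacePNat : DiscreteMeasurableSpace ℕ+ := ⟨fun _ => trivial⟩

/-- The set `T_n` of vertices reached from the vertex `n : ℤ` in the directed graph on `ℤ` in which
every integer `n ≥ 1` has the two outgoing edges `n → n - z_n` and `n → n - w_n`:
`T_n = {n}` for `n ≤ 0`, and `T_n = {n} ∪ T_{n - z_n} ∪ T_{n - w_n}` for `n ≥ 1`. -/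
def reached (z w : ℕ+ → ℕ+) (n : ℤ) : Finset ℤ :=
  if h : 1 ≤ n then
    {n} ∪ reached z w (n - ((z ⟨n.toNat, by omega⟩ : ℕ) : ℤ))
      ∪ reached z w (n - ((w ⟨n.toNat, by omega⟩ : ℕ) : ℤ))
  else {n}
termination_by n.toNat
decreasing_by
  · have := (z ⟨n.toNat, by omega⟩).pos
    omega
  · have := (w ⟨n.toNat, by omega⟩).pos
    omega

/-- The set of leaves reached from `n`: the vertices of `T_n` with non-positive index. -/
def leaves (z w : ℕ+ → ℕ+) (n : ℤ) : Finset ℤ :=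
  (reached z w n).filter (fun i => i ≤ 0)

/-- The number `Λ_n` of leaves reached from `n`. -/
def numLeaves (z w : ℕ+ → ℕ+) (n : ℤ) : ℕ :=
  (leaves z w n).card

/-- The law of a positive-integer-valued random variable is aperiodic: the greatest common divisor
of its support `{k : P(X = k) > 0}` is `1`. -/
def AperiodicLaw {Ω : Type*} [MeasurableSpace Ω] (μ : Measure Ω) (X : Ω → ℕ+) : Prop :=
  Nat.setGcd {k : ℕ | 0 < μ {ω | (X ω : ℕ) = k}} = 1

theorem reached_of_nonpos (z w : ℕ+ → ℕ+) {n : ℤ} (hn : n ≤ 0) : reached z w n = {n} := by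
  rw [reached, dif_neg (by omega)]

theorem reached_coe (z w : ℕ+ → ℕ+) (n : ℕ+) :
    reached z w ((n : ℕ) : ℤ) = {((n : ℕ) : ℤ)}
      ∪ reached z w (((n : ℕ) : ℤ) - ((z n : ℕ) : ℤ))
      ∪ reached z w (((n : ℕ) : ℤ) - ((w n : ℕ) : ℤ)) := by
  have hn := n.pos
  rw [reached, dif_pos (by omega)]
  rfl

end TwoChoice

/-!
Call a vertex `r` a regeneration point if every vertex far enough above it reaches it. Then
`T_r ⊆ T_n` for all large `n`, so `Λ_n → ∞` as soon as there are infinitely many regeneration points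
`r` whose edge `r → r - Z_r` ends in a leaf, and these leaves take infinitely many values.

To find regeneration points, let `D` be the additive monoid generated by the support of the law of
`Z`; by aperiodicity it contains every integer `≥ c`, for some `c`. It suffices (`Regen`) that for
each positive `j ∈ D` the vertex `r + j` has an edge into `r + D`: descending along these edges,
every `r + d` with `d ∈ D` reaches `r` (`Regen.reached_subset`). For each `j` this has positive
probability, and for large `j` it fails only if both edges at `r + j` are longer than `j - c`. Since
`∑ P(Z > j)² = E min(Z, W) < ∞`, the event `Regen` has probability at least some `p > 0` that does
not depend on `r` (`exists_pos_le_measure_regen`).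

The events `Z_r ≥ r` are independent and `∑ P(Z ≥ r) = E Z = ∞`, so infinitely many of them occur.
Let `τ` be the first `r > N` at which this happens. The event `τ = r` depends on vertices up to `r`
only, whereas `Regen` at `r` depends on vertices above `r` only; hence with probability at least `p`
the vertex `τ` is a regeneration point. Letting `N → ∞`, with probability at least `p` infinitely
many regeneration points satisfy `Z_r ≥ r`. This is a tail event, so by Kolmogorov's zero-one law
its probability is `1` (`measure_frequently_regen_jump_eq_one`).

Finally, a leaf `-l` is the endpoint of `r → r - Z_r` for finitely many `r` only, by Borel–Cantelli
and `∑_r P(Z = r + l) ≤ 1` (`ae_forall_finite_fiber`); so infinitely many such edges end in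
infinitely many leaves (`tendsto_numLeaves_of_infinite_regen`).
-/

namespace TwoChoice

/-! ### Regeneration points -/

/-- For every positive `j ∈ D`, the vertex `r + j` has an edge into `r + D`. When `D` is cofinite,
this makes every vertex far enough above `r` reach `r`. -/
def Regen (D : Set ℕ) (z w : ℕ+ → ℕ+) (r : ℕ+) : Prop :=
  ∀ j : ℕ+, (j : ℕ) ∈ D → ∃ d ∈ D, d + (z (r + j) : ℕ) = j ∨ d + (w (r + j) : ℕ) = j

theorem reached_step_left (z w : ℕ+ → ℕ+) (n : ℕ+) :
    reached z w (((n : ℕ) : ℤ) - ((z n : ℕ) : ℤ)) ⊆ reached z w ((n : ℕ) : ℤ) := by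
  rw [reached_coe z w n]
  exact fun x hx => by simp [hx]

theorem reached_step_right (z w : ℕ+ → ℕ+) (n : ℕ+) :
    reached z w (((n : ℕ) : ℤ) - ((w n : ℕ) : ℤ)) ⊆ reached z w ((n : ℕ) : ℤ) := by
  rw [reached_coe z w n]
  exact fun x hx => by simp [hx]

theorem Regen.reached_subset {D : Set ℕ} {z w : ℕ+ → ℕ+} {r : ℕ+} (h : Regen D z w r)
    {d : ℕ} (hd : d ∈ D) :
    reached z w ((r : ℕ) : ℤ) ⊆ reached z w (((r : ℕ) : ℤ) + d) := by
  induction d using Nat.strong_induction_on with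
  | _ d ih =>
    rcases Nat.eq_zero_or_pos d with rfl | hpos
    · simp
    · lift d to ℕ+ using hpos
      obtain ⟨e, he, hstep⟩ := h d hd
      have hcast : (((r + d : ℕ+) : ℕ) : ℤ) = ((r : ℕ) : ℤ) + ((d : ℕ) : ℤ) := by
        rw [PNat.add_coe, Nat.cast_add]
      rcases hstep with hz | hz
      · have hlt := (z (r + d)).pos
        refine (ih e (by omega) he).trans ?_
        have := reached_step_left z w (r + d)
        rw [hcast] at this
        convert this using 2
        omega
      · have hlt := (w (r + d)).pos
        refine (ih e (by omega) he).trans ?_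
        have := reached_step_right z w (r + d)
        rw [hcast] at this
        convert this using 2
        omega

/-- Deterministic part of the argument: infinitely many regeneration points `r` with `r - z r ≤ 0`
produce infinitely many leaves, each of which is reached from all large `n`. -/
theorem tendsto_numLeaves_of_infinite_regen {D : Set ℕ} {z w : ℕ+ → ℕ+} {c : ℕ}
    (hc : ∀ m, c ≤ m → m ∈ D)
    (hinf : {r : ℕ+ | Regen D z w r ∧ r ≤ z r}.Infinite)
    (hfib : ∀ l : ℕ, {r : ℕ+ | (z r : ℕ) = r + l}.Finite) :
    Tendsto (fun n : ℕ => numLeaves z w (n : ℤ)) atTop atTop := by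
  set R : Set ℕ+ := {r : ℕ+ | Regen D z w r ∧ r ≤ z r}
  set g : ℕ+ → ℤ := fun r => ((r : ℕ) : ℤ) - ((z r : ℕ) : ℤ)
  -- An infinite set has infinite image under a map with finite fibres.
  have himg : (g '' R).Infinite := by
    intro hfin
    refine hinf ((hfin.preimage' (f := g) ?_).subset (Set.subset_preimage_image g R))
    rintro _ ⟨r, hr, rfl⟩
    refine (hfib ((z r : ℕ) - r)).subset fun s hs => ?_
    have hle : (r : ℕ) ≤ z r := hr.2
    have hs' : ((s : ℕ) : ℤ) - ((z s : ℕ) : ℤ) = ((r : ℕ) : ℤ) - ((z r : ℕ) : ℤ) := hs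
    simp only [Set.mem_ofPred_eq]
    omega
  rw [tendsto_atTop]
  intro K
  obtain ⟨t, htR, htK⟩ := himg.exists_subset_card_eq K
  have key : ∀ l ∈ t, ∀ᶠ n : ℕ in atTop, l ∈ leaves z w (n : ℤ) := by
    intro l hl
    obtain ⟨r, hr, rfl⟩ := htR hl
    have hle : (r : ℕ) ≤ z r := hr.2
    filter_upwards [eventually_ge_atTop ((r : ℕ) + c)] with n hn
    have hsub := hr.1.reached_subset (hc (n - r) (by omega))
    have hn' : ((r : ℕ) : ℤ) + ((n - (r : ℕ) : ℕ) : ℤ) = (n : ℤ) := by omega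
    rw [hn'] at hsub
    have hg : g r ≤ 0 := by simp only [g]; omega
    refine Finset.mem_filter.2 ⟨hsub (reached_step_left z w r ?_), hg⟩
    rw [reached_of_nonpos z w hg]
    simp [g]
  filter_upwards [(Filter.eventually_all_finset t).2 key] with n hn
  rw [← htK]
  exact Finset.card_le_card hn

theorem exists_add_eq_of_mem_closure {S : Set ℕ} {j : ℕ} (hj : j ∈ AddSubmonoid.closure S)
    (hj0 : j ≠ 0) : ∃ d ∈ AddSubmonoid.closure S, ∃ s ∈ S, d + s = j := by
  induction hj using AddSubmonoid.closure_induction with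
  | mem x hx => exact ⟨0, zero_mem _, x, hx, zero_add x⟩
  | zero => exact absurd rfl hj0
  | add x y hx hy ihx ihy =>
    rcases eq_or_ne y 0 with rfl | hy0
    · simpa using ihx (by simpa using hj0)
    · obtain ⟨d, hd, s, hs, rfl⟩ := ihy hy0
      exact ⟨x + d, add_mem hx hd, s, hs, by ring⟩

theorem exists_forall_ge_mem_closure {S : Set ℕ} (hS : Nat.setGcd S = 1) :
    ∃ c, ∀ m, c ≤ m → m ∈ AddSubmonoid.closure S := by
  obtain ⟨c, hc⟩ := Nat.exists_mem_closure_of_ge S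
  exact ⟨c, fun m hm => hc m hm (by simp [hS])⟩

/-! ### Events determined by the edges out of a set of vertices -/

/-- The vertex from which an edge starts; `Sum.inl k` and `Sum.inr k` index the two edges out of the
vertex `k`. -/
def vertexOf : ℕ+ ⊕ ℕ+ → ℕ+ := Sum.elim id id

/-- The σ-algebra generated by the lengths of the edges out of the vertices in `S`. -/
abbrev sigmaOn {Ω : Type*} (Zs Ws : ℕ+ → Ω → ℕ+) (S : Set ℕ+) : MeasurableSpace Ω :=
  ⨆ i ∈ vertexOf ⁻¹' S, MeasurableSpace.comap (Sum.elim Zs Ws i) inferInstance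

section

variable {Ω : Type*} {Zs Ws : ℕ+ → Ω → ℕ+}

theorem measurable_sigmaOn_left {S : Set ℕ+} {k : ℕ+} (hk : k ∈ S) :
    Measurable[sigmaOn Zs Ws S] (Zs k) := by
  refine Measurable.mono (comap_measurable (Zs k)) ?_ le_rfl
  exact le_iSup₂_of_le (f := fun i (_ : i ∈ vertexOf ⁻¹' S) =>
    MeasurableSpace.comap (Sum.elim Zs Ws i) inferInstance) (Sum.inl k) hk le_rfl

theorem measurable_sigmaOn_right {S : Set ℕ+} {k : ℕ+} (hk : k ∈ S) :
    Measurable[sigmaOn Zs Ws S] (Ws k) := by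
  refine Measurable.mono (comap_measurable (Ws k)) ?_ le_rfl
  exact le_iSup₂_of_le (f := fun i (_ : i ∈ vertexOf ⁻¹' S) =>
    MeasurableSpace.comap (Sum.elim Zs Ws i) inferInstance) (Sum.inr k) hk le_rfl

theorem measurableSet_regen [MeasurableSpace Ω] {D : Set ℕ} {r : ℕ+}
    (hZ : ∀ k, r < k → Measurable (Zs k)) (hW : ∀ k, r < k → Measurable (Ws k)) :
    MeasurableSet {ω | Regen D (fun k => Zs k ω) (fun k => Ws k ω) r} := by
  have hset : {ω | Regen D (fun k => Zs k ω) (fun k => Ws k ω) r} =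
      ⋂ j : ℕ+, ⋂ _ : (j : ℕ) ∈ D,
        (Zs (r + j) ⁻¹' {k | ∃ d ∈ D, d + (k : ℕ) = j} ∪
          Ws (r + j) ⁻¹' {k | ∃ d ∈ D, d + (k : ℕ) = j}) := by
    ext ω
    simp only [Regen, Set.mem_ofPred_eq, Set.mem_iInter, Set.mem_union, Set.mem_preimage]
    refine forall₂_congr fun j hj => ?_
    grind
  rw [hset]
  refine MeasurableSet.iInter fun j => MeasurableSet.iInter fun _ => ?_
  exact (hZ _ (PNat.lt_add_right r j) (MeasurableSet.of_discrete)).union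
    (hW _ (PNat.lt_add_right r j) (MeasurableSet.of_discrete))

/-- The event that infinitely many regeneration points `r` satisfy `r ≤ Z_r` does not depend on the
vertices up to `M`, for any given `M`. -/
theorem measurableSet_frequently_regen_jump [MeasurableSpace Ω] {D : Set ℕ} (M : ℕ+)
    (hZ : ∀ k, M < k → Measurable (Zs k)) (hW : ∀ k, M < k → Measurable (Ws k)) :
    MeasurableSet {ω | ∀ N : ℕ+, ∃ r, N < r ∧
      Regen D (fun k => Zs k ω) (fun k => Ws k ω) r ∧ r ≤ Zs r ω} := by
  have hset : {ω | ∀ N : ℕ+, ∃ r, N < r ∧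
      Regen D (fun k => Zs k ω) (fun k => Ws k ω) r ∧ r ≤ Zs r ω} =
      ⋂ N : ℕ+, ⋃ r : ℕ+, ⋃ _ : max N M < r,
        ({ω | Regen D (fun k => Zs k ω) (fun k => Ws k ω) r} ∩ Zs r ⁻¹' {k | r ≤ k}) := by
    ext ω
    simp only [Set.mem_ofPred_eq, Set.mem_iInter, Set.mem_iUnion, Set.mem_inter_iff,
      Set.mem_preimage, exists_prop]
    refine ⟨fun h N => h _, fun h N => ?_⟩
    obtain ⟨r, hr, h'⟩ := h N
    exact ⟨r, (le_max_left _ _).trans_lt hr, h'⟩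
  rw [hset]
  refine MeasurableSet.iInter fun N => MeasurableSet.iUnion fun r =>
    MeasurableSet.iUnion fun hr => ?_
  have hMr : M < r := (le_max_right _ _).trans_lt hr
  exact (measurableSet_regen (fun k hk => hZ k (hMr.trans hk))
    (fun k hk => hW k (hMr.trans hk))).inter (hZ r hMr MeasurableSet.of_discrete)

variable [MeasurableSpace Ω] {μ : Measure Ω}

theorem comap_sumElim_le (hZm : ∀ k, Measurable (Zs k)) (hWm : ∀ k, Measurable (Ws k))
    (i : ℕ+ ⊕ ℕ+) :
    MeasurableSpace.comap (Sum.elim Zs Ws i) inferInstance ≤ (inferInstance : MeasurableSpace Ω) := by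
  rcases i with k | k
  exacts [(hZm k).comap_le, (hWm k).comap_le]

theorem indep_sigmaOn (hZm : ∀ k, Measurable (Zs k)) (hWm : ∀ k, Measurable (Ws k))
    (h_indep : iIndepFun (Sum.elim Zs Ws) μ) {S T : Set ℕ+} (hST : Disjoint S T) :
    Indep (sigmaOn Zs Ws S) (sigmaOn Zs Ws T) μ :=
  indep_iSup_of_disjoint (comap_sumElim_le hZm hWm) h_indep.iIndep (hST.preimage vertexOf)

/-- Kolmogorov's zero-one law along the cofinite filter on the set of edges. -/
theorem measure_frequently_regen_jump_eq_zero_or_one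
    (hZm : ∀ k, Measurable (Zs k)) (hWm : ∀ k, Measurable (Ws k))
    (h_indep : iIndepFun (Sum.elim Zs Ws) μ) (D : Set ℕ) :
    μ {ω | ∀ N : ℕ+, ∃ r, N < r ∧
      Regen D (fun k => Zs k ω) (fun k => Ws k ω) r ∧ r ≤ Zs r ω} = 0 ∨
    μ {ω | ∀ N : ℕ+, ∃ r, N < r ∧
      Regen D (fun k => Zs k ω) (fun k => Ws k ω) r ∧ r ≤ Zs r ω} = 1 := by
  refine measure_zero_or_one_of_measurableSet_limsup (f := cofinite) (p := Set.Finite)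
    (ns := fun F : Finset (ℕ+ ⊕ ℕ+) => (F : Set (ℕ+ ⊕ ℕ+)))
    (comap_sumElim_le hZm hWm) h_indep.iIndep (fun t ht => ht.compl_mem_cofinite)
    (fun F G => by
      classical
      exact ⟨F ∪ G, by simp, by simp⟩)
    (fun F => F.finite_toSet) (fun i => ⟨{i}, by simp⟩) ?_
  rw [hasBasis_cofinite.limsup_eq_iInf_iSup, MeasurableSpace.measurableSet_iInf]
  intro F
  rw [MeasurableSpace.measurableSet_iInf]
  intro hF
  obtain ⟨M, hM⟩ := (hF.image vertexOf).bddAbove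
  have hle : sigmaOn Zs Ws (Set.Ioi M) ≤
      ⨆ i ∈ Fᶜ, MeasurableSpace.comap (Sum.elim Zs Ws i) inferInstance := by
    refine biSup_mono fun i hi hiF => ?_
    exact (not_le_of_gt hi) (hM ⟨i, hiF, rfl⟩)
  exact hle _ (@measurableSet_frequently_regen_jump Ω Zs Ws (sigmaOn Zs Ws (Set.Ioi M)) D M
    (fun k hk => measurable_sigmaOn_left hk) (fun k hk => measurable_sigmaOn_right hk))

/-- If some `A n` occurs almost surely, and each `R n` is independent of the event that `n` is the
first index at which `A n` occurs, then `A n ∩ R n` occurs for some `n` with probability at least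
`inf μ (R n)`. -/
theorem le_measure_iUnion_inter_of_indep_disjointed {A R : ℕ → Set Ω} {p : ℝ≥0∞}
    (hA : ∀ n, MeasurableSet (A n)) (hR : ∀ n, MeasurableSet (R n))
    (hAR : ∀ n, μ (disjointed A n ∩ R n) = μ (disjointed A n) * μ (R n))
    (hp : ∀ n, p ≤ μ (R n)) (h1 : μ (⋃ n, A n) = 1) :
    p ≤ μ (⋃ n, A n ∩ R n) := by
  have hdm : ∀ n, MeasurableSet (disjointed A n) := fun n => MeasurableSet.disjointed hA n
  calc p = (∑' n, μ (disjointed A n)) * p := by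
        rw [← measure_iUnion (disjoint_disjointed A) hdm, iUnion_disjointed, h1, one_mul]
    _ = ∑' n, μ (disjointed A n) * p := ENNReal.tsum_mul_right.symm
    _ ≤ ∑' n, μ (disjointed A n ∩ R n) :=
        ENNReal.tsum_le_tsum fun n => by
          rw [hAR]
          exact mul_le_mul_right (hp n) _
    _ = μ (⋃ n, disjointed A n ∩ R n) :=
        (measure_iUnion (fun i j hij => ((disjoint_disjointed A) hij).mono Set.inter_subset_left
          Set.inter_subset_left) fun n => (hdm n).inter (hR n)).symm
    _ ≤ μ (⋃ n, A n ∩ R n) :=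
        measure_mono (Set.iUnion_mono fun n => Set.inter_subset_inter_left _ (disjointed_subset A n))

end

/-! ### Probability of regeneration, and almost sure divergence -/

theorem lintegral_natCast_eq_tsum_measure_lt {Ω : Type*} [MeasurableSpace Ω] {μ : Measure Ω}
    {f : Ω → ℕ} (hf : AEMeasurable f μ) :
    ∫⁻ ω, (f ω : ℝ≥0∞) ∂μ = ∑' j : ℕ, μ {ω | j < f ω} := by
  have hnull : ∀ j : ℕ, NullMeasurableSet {ω | j < f ω} μ := fun j =>
    hf.nullMeasurableSet_preimage (MeasurableSet.of_discrete (s := Set.Ioi j))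
  have hpt : ∀ ω, (f ω : ℝ≥0∞) = ∑' j : ℕ, {ω | j < f ω}.indicator (fun _ => (1 : ℝ≥0∞)) ω := by
    intro ω
    rw [tsum_eq_sum (s := Finset.range (f ω)) fun j hj => by
      simpa using hj]
    rw [Finset.sum_congr rfl fun j hj =>
      Set.indicator_of_mem (s := {ω | j < f ω}) (Finset.mem_range.1 hj) _]
    simp
  simp_rw [hpt]
  rw [lintegral_tsum fun j => aemeasurable_const.indicator₀ (hnull j)]
  exact tsum_congr fun j => by rw [lintegral_indicator_const₀ (hnull j), one_mul]

section

variable {Ω : Type*} [MeasurableSpace Ω] {μ : Measure Ω} {Zs Ws : ℕ+ → Ω → ℕ+}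
  {ν : Measure ℕ+}

/-- The tail of the product of the probabilities over `j` is bounded below by a union bound, and its
head, a finite product, is positive because each vertex of `D` can step inside `D`. -/
theorem exists_pos_le_measure_regen [IsProbabilityMeasure μ]
    (hZm : ∀ k, Measurable (Zs k)) (hWm : ∀ k, Measurable (Ws k))
    (h_indep : iIndepFun (Sum.elim Zs Ws) μ)
    (hZ : ∀ n A, μ (Zs n ⁻¹' A) = ν A) (hW : ∀ n A, μ (Ws n ⁻¹' A) = ν A)
    {D : Set ℕ} {c : ℕ} (hc : ∀ m, c ≤ m → m ∈ D)
    (hD : ∀ j : ℕ, j ≠ 0 → j ∈ D → 0 < ν {k | ∃ d ∈ D, d + (k : ℕ) = j})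
    (h_sq : ∑' j : ℕ, ν {k | j < (k : ℕ)} ^ 2 ≠ ∞) :
    ∃ p : ℝ≥0∞, 0 < p ∧
      ∀ r, p ≤ μ {ω | Regen D (fun k => Zs k ω) (fun k => Ws k ω) r} := by
  obtain ⟨M, hM⟩ : ∃ M, ∑' k : ℕ, ν {n | k + M < (n : ℕ)} ^ 2 < 1 / 2 :=
    ((ENNReal.tendsto_sum_nat_add _ h_sq).eventually_lt_const (by simp)).exists
  set G : ℕ → Set ℕ+ := fun i => {k | i + 1 ∈ D → ∃ d ∈ D, d + (k : ℕ) = i + 1}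
  have hν1 : ν Set.univ = 1 := by rw [← hZ 1, Set.preimage_univ, measure_univ]
  have hG : ∀ i, 0 < ν (G i) := by
    intro i
    by_cases hi : i + 1 ∈ D
    · simpa [G, hi] using hD (i + 1) (by omega) hi
    · simp [G, hi, hν1]
  refine ⟨(∏ i ∈ Finset.range (c + M), ν (G i)) * (1 / 2),
    ENNReal.mul_pos (Finset.prod_ne_zero_iff.2 fun i _ => (hG i).ne') (by simp), fun r => ?_⟩
  -- `E₁` controls the `c + M` vertices just above `r`; `B k` is the event that both edges out of
  -- the vertex `r + j`, with `j = c + M + k + 1`, are too long to be sure to end in `r + D`.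
  set E₁ : Set Ω := ⋂ i ∈ Finset.range (c + M), Zs (r + i.succPNat) ⁻¹' G i
  set B : ℕ → Set Ω := fun k => Zs (r + (c + M + k).succPNat) ⁻¹' {n | k + M < (n : ℕ)} ∩
    Ws (r + (c + M + k).succPNat) ⁻¹' {n | k + M < (n : ℕ)}
  have hE₁ : μ E₁ = ∏ i ∈ Finset.range (c + M), ν (G i) := by
    have hinj : Function.Injective fun i : ℕ => (Sum.inl (r + i.succPNat) : ℕ+ ⊕ ℕ+) :=
      fun a b hab => Nat.succPNat_injective (add_left_cancel (Sum.inl_injective hab))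
    rw [(h_indep.precomp hinj).meas_biInter (s := fun i => Zs (r + i.succPNat) ⁻¹' G i)
      fun i _ => ⟨G i, MeasurableSet.of_discrete, rfl⟩]
    exact Finset.prod_congr rfl fun i _ => hZ _ _
  have hB : ∀ k, μ (B k) = ν {n | k + M < (n : ℕ)} ^ 2 := by
    intro k
    have hind : IndepFun (Zs (r + (c + M + k).succPNat)) (Ws (r + (c + M + k).succPNat)) μ :=
      h_indep.indepFun (i := Sum.inl _) (j := Sum.inr _) (by simp)
    rw [hind.measure_inter_preimage_eq_mul _ _ MeasurableSet.of_discrete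
      MeasurableSet.of_discrete, hZ, hW, sq]
  have hBm : ∀ k, MeasurableSet (B k) := fun k =>
    (hZm _ MeasurableSet.of_discrete).inter (hWm _ MeasurableSet.of_discrete)
  have hE₂ : 1 / 2 ≤ μ (⋃ k, B k)ᶜ := by
    rw [prob_compl_eq_one_sub (MeasurableSet.iUnion hBm)]
    have hle : μ (⋃ k, B k) ≤ 1 / 2 := (measure_iUnion_le B).trans (by simpa only [hB] using hM.le)
    calc (1 / 2 : ℝ≥0∞) = 1 - 1 / 2 := by simp
      _ ≤ 1 - μ (⋃ k, B k) := tsub_le_tsub_left hle 1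
  have hind : μ (E₁ ∩ (⋃ k, B k)ᶜ) = μ E₁ * μ (⋃ k, B k)ᶜ := by
    refine (Indep_iff _ _ μ).1 (indep_sigmaOn hZm hWm h_indep
      (S := Set.Iio (r + (c + M).succPNat)) (T := Set.Ici (r + (c + M).succPNat))
      (Set.disjoint_left.2 fun x hx hx' => not_lt_of_ge (Set.mem_Ici.1 hx') (Set.mem_Iio.1 hx))) _ _ ?_ ?_
    · refine @Finset.measurableSet_biInter _ _ (_) _ _ fun i hi => ?_
      exact measurable_sigmaOn_left (add_lt_add_right
        (Nat.succPNat_strictMono (Finset.mem_range.1 hi)) r) MeasurableSet.of_discrete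
    · have hk : ∀ k, r + (c + M + k).succPNat ∈ Set.Ici (r + (c + M).succPNat) := fun k =>
        add_le_add_right (Nat.succPNat_mono (Nat.le_add_right _ k)) r
      refine @MeasurableSet.compl _ _ (_) (@MeasurableSet.iUnion _ _ (_) _ _ fun k => ?_)
      exact @MeasurableSet.inter _ (_) _ _
        (measurable_sigmaOn_left (hk k) MeasurableSet.of_discrete)
        (measurable_sigmaOn_right (hk k) MeasurableSet.of_discrete)
  calc (∏ i ∈ Finset.range (c + M), ν (G i)) * (1 / 2) ≤ μ E₁ * μ (⋃ k, B k)ᶜ := by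
        rw [hE₁]
        exact mul_le_mul_right hE₂ _
    _ = μ (E₁ ∩ (⋃ k, B k)ᶜ) := hind.symm
    _ ≤ _ := measure_mono ?_
  rintro ω ⟨h₁, h₂⟩ j hj
  obtain ⟨i, rfl⟩ : ∃ i : ℕ, i.succPNat = j := ⟨j.natPred, PNat.succPNat_natPred j⟩
  rw [Nat.succPNat_coe] at hj ⊢
  rcases lt_or_ge i (c + M) with hi | hi
  · obtain ⟨d, hd, hdj⟩ := Set.mem_iInter₂.1 h₁ i (Finset.mem_range.2 hi) hj
    exact ⟨d, hd, Or.inl hdj⟩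
  · obtain ⟨k, rfl⟩ := Nat.exists_eq_add_of_le hi
    have hk : ω ∉ B k := fun h => h₂ (Set.mem_iUnion.2 ⟨k, h⟩)
    have hk' : (Zs (r + (c + M + k).succPNat) ω : ℕ) ≤ k + M ∨
        (Ws (r + (c + M + k).succPNat) ω : ℕ) ≤ k + M := by
      by_contra! hcon
      exact hk hcon
    rcases hk' with h | h
    · exact ⟨c + M + k + 1 - Zs (r + (c + M + k).succPNat) ω, hc _ (by omega),
        Or.inl (by dsimp only; omega)⟩
    · exact ⟨c + M + k + 1 - Ws (r + (c + M + k).succPNat) ω, hc _ (by omega),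
        Or.inr (by dsimp only; omega)⟩

/-- Almost surely infinitely many regeneration points `r` have an edge `r → r - Z_r` that ends in a
leaf. -/
theorem measure_frequently_regen_jump_eq_one [IsProbabilityMeasure μ]
    (hZm : ∀ k, Measurable (Zs k)) (hWm : ∀ k, Measurable (Ws k))
    (h_indep : iIndepFun (Sum.elim Zs Ws) μ)
    (hZ : ∀ n A, μ (Zs n ⁻¹' A) = ν A)
    (h_sum : ∑' j : ℕ, ν {k | j < (k : ℕ)} = ∞)
    {D : Set ℕ} {p : ℝ≥0∞} (hp0 : 0 < p)
    (hp : ∀ r, p ≤ μ {ω | Regen D (fun k => Zs k ω) (fun k => Ws k ω) r}) :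
    μ {ω | ∀ N : ℕ+, ∃ r, N < r ∧
      Regen D (fun k => Zs k ω) (fun k => Ws k ω) r ∧ r ≤ Zs r ω} = 1 := by
  refine (measure_frequently_regen_jump_eq_zero_or_one hZm hWm h_indep D).resolve_left ?_
  set R : ℕ+ → Set Ω := fun r => {ω | Regen D (fun k => Zs k ω) (fun k => Ws k ω) r}
  set A : ℕ+ → Set Ω := fun r => Zs r ⁻¹' {k | r ≤ k}
  have hAm : ∀ r, MeasurableSet (A r) := fun r => hZm r MeasurableSet.of_discrete
  have hRm : ∀ r, MeasurableSet (R r) := fun r =>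
    measurableSet_regen (fun k _ => hZm k) fun k _ => hWm k
  have hlim : μ (limsup (fun n : ℕ => A n.succPNat) atTop) = 1 := by
    refine measure_limsup_eq_one (fun n => hAm _) ?_ ?_
    · have hinj : Function.Injective fun i : ℕ => (Sum.inl i.succPNat : ℕ+ ⊕ ℕ+) :=
        fun a b hab => Nat.succPNat_injective (Sum.inl_injective hab)
      rw [iIndepSet_iff_meas_biInter fun n => hAm _]
      intro s
      exact (h_indep.precomp hinj).meas_biInter (s := fun i : ℕ => A i.succPNat)
        fun i _ => ⟨{k | i.succPNat ≤ k}, MeasurableSet.of_discrete, rfl⟩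
    · rw [← h_sum]
      refine tsum_congr fun n => ?_
      rw [hZ]
      rfl
  -- The first jump to a leaf after `N` is made from a regeneration point with probability `≥ p`.
  have hU : ∀ N : ℕ+, p ≤ μ (⋃ n : ℕ, A (N + n.succPNat) ∩ R (N + n.succPNat)) := by
    intro N
    refine le_measure_iUnion_inter_of_indep_disjointed (fun n => hAm _) (fun n => hRm _) ?_
      (fun n => hp _) ?_
    · intro n
      refine (Indep_iff _ _ μ).1 (indep_sigmaOn hZm hWm h_indep
        (S := Set.Iic (N + n.succPNat)) (T := Set.Ioi (N + n.succPNat))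
        (Set.disjoint_left.2 fun x hx hx' => not_lt_of_ge (Set.mem_Iic.1 hx) (Set.mem_Ioi.1 hx'))) _ _ ?_ ?_
      · have hA' : ∀ m ≤ n, MeasurableSet[sigmaOn Zs Ws (Set.Iic (N + n.succPNat))]
            (A (N + m.succPNat)) := fun m hm =>
          measurable_sigmaOn_left (add_le_add_right (Nat.succPNat_mono hm) N)
            MeasurableSet.of_discrete
        rw [disjointed_eq_inter_compl]
        refine @MeasurableSet.inter _ (_) _ _ (hA' n le_rfl)
          (@MeasurableSet.iInter _ _ (_) _ _ fun m => @MeasurableSet.iInter _ _ (_) _ _ fun hm =>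
            @MeasurableSet.compl _ _ (_) (hA' m hm.le))
      · exact @measurableSet_regen Ω Zs Ws (sigmaOn Zs Ws (Set.Ioi (N + n.succPNat))) D _
          (fun k hk => measurable_sigmaOn_left hk) (fun k hk => measurable_sigmaOn_right hk)
    · refine le_antisymm prob_le_one (hlim ▸ measure_mono fun ω hω => ?_)
      rw [mem_limsup_iff_frequently_mem, frequently_atTop] at hω
      obtain ⟨m, hm, hωm⟩ := hω N
      refine Set.mem_iUnion.2 ⟨m - N, ?_⟩
      convert hωm using 2
      apply PNat.eq
      simp only [PNat.add_coe, Nat.succPNat_coe]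
      omega
  have hset : {ω | ∀ N : ℕ+, ∃ r, N < r ∧
      Regen D (fun k => Zs k ω) (fun k => Ws k ω) r ∧ r ≤ Zs r ω} =
      ⋂ N : ℕ+, ⋃ r : ℕ+, ⋃ _ : N < r, A r ∩ R r := by
    ext ω
    simp only [Set.mem_ofPred_eq, Set.mem_iInter, Set.mem_iUnion, Set.mem_inter_iff,
      Set.mem_preimage, exists_prop, A, R, and_comm]
  have hanti : Antitone fun N : ℕ+ => ⋃ r : ℕ+, ⋃ _ : N < r, A r ∩ R r := fun N N' hN =>
    Set.iUnion_mono fun r => Set.iUnion_mono' fun hr => ⟨hN.trans_lt hr, le_rfl⟩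
  rw [hset]
  refine (hp0.trans_le (ge_of_tendsto' (tendsto_measure_iInter_atTop
    (fun N => (MeasurableSet.iUnion fun r => MeasurableSet.iUnion fun _ =>
      (hAm r).inter (hRm r)).nullMeasurableSet) hanti ⟨1, measure_ne_top _ _⟩) fun N => ?_)).ne'
  refine (hU N).trans (measure_mono (Set.iUnion_subset fun n => ?_))
  exact Set.subset_iUnion₂_of_subset (N + n.succPNat) (PNat.lt_add_right _ _) le_rfl

/-- Almost surely each leaf `-l` is the endpoint of `r → r - Z_r` for finitely many `r` only: the
events `Z_r = r + l` have the probabilities of disjoint events under the law of `Z`. -/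
theorem ae_forall_finite_fiber
    (hZ : ∀ n A, μ (Zs n ⁻¹' A) = ν A) [IsFiniteMeasure ν] :
    ∀ᵐ ω ∂μ, ∀ l : ℕ, {r : ℕ+ | (Zs r ω : ℕ) = r + l}.Finite := by
  rw [ae_all_iff]
  intro l
  refine ae_finite_setOfPred_mem (s := fun r : ℕ+ => {ω | (Zs r ω : ℕ) = r + l}) ?_
  have h1 : ∀ r : ℕ+, μ {ω | (Zs r ω : ℕ) = r + l} = ν {k | (k : ℕ) = r + l} :=
    fun r => hZ r {k | (k : ℕ) = r + l}
  simp_rw [h1]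
  rw [← measure_iUnion]
  · exact measure_ne_top _ _
  · intro a b hab
    refine Set.disjoint_left.2 fun k hk hk' => hab (PNat.eq ?_)
    have h2 : (k : ℕ) = a + l := hk
    have h3 : (k : ℕ) = b + l := hk'
    omega
  · exact fun _ => MeasurableSet.of_discrete

/-- The main result for measurable edge lengths, with hypotheses on their common law `ν`. -/
theorem ae_tendsto_numLeaves [IsProbabilityMeasure μ]
    (hZm : ∀ k, Measurable (Zs k)) (hWm : ∀ k, Measurable (Ws k))
    (h_indep : iIndepFun (Sum.elim Zs Ws) μ)
    (hZ : ∀ n A, μ (Zs n ⁻¹' A) = ν A) (hW : ∀ n A, μ (Ws n ⁻¹' A) = ν A)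
    (h_gcd : Nat.setGcd {j : ℕ | 0 < ν {k | (k : ℕ) = j}} = 1)
    (h_sum : ∑' j : ℕ, ν {k | j < (k : ℕ)} = ∞)
    (h_sq : ∑' j : ℕ, ν {k | j < (k : ℕ)} ^ 2 ≠ ∞) :
    ∀ᵐ ω ∂μ, Tendsto
      (fun n : ℕ => numLeaves (fun k => Zs k ω) (fun k => Ws k ω) (n : ℤ)) atTop atTop := by
  have : IsFiniteMeasure ν := ⟨by
    rw [← hZ 1, Set.preimage_univ, measure_univ]
    exact ENNReal.one_lt_top⟩
  set D : Set ℕ := (AddSubmonoid.closure {j : ℕ | 0 < ν {k | (k : ℕ) = j}} : Set ℕ)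
  obtain ⟨c, hc⟩ := exists_forall_ge_mem_closure h_gcd
  obtain ⟨p, hp0, hp⟩ := exists_pos_le_measure_regen hZm hWm h_indep hZ hW (D := D) hc
    (fun j hj0 hj => by
      obtain ⟨d, hd, s, hs, rfl⟩ := exists_add_eq_of_mem_closure hj hj0
      refine lt_of_lt_of_le hs (measure_mono fun k hk => ⟨d, hd, ?_⟩)
      rw [show (k : ℕ) = s from hk]) h_sq
  have hone := measure_frequently_regen_jump_eq_one hZm hWm h_indep hZ h_sum hp0 hp
  have hmeas : MeasurableSet {ω | ∀ N : ℕ+, ∃ r, N < r ∧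
      Regen D (fun k => Zs k ω) (fun k => Ws k ω) r ∧ r ≤ Zs r ω} :=
    measurableSet_frequently_regen_jump 1 (fun k _ => hZm k) fun k _ => hWm k
  filter_upwards [(prob_compl_eq_zero_iff hmeas).2 hone, ae_forall_finite_fiber hZ] with ω h1 h2
  refine tendsto_numLeaves_of_infinite_regen hc (Set.infinite_of_not_bddAbove ?_) h2
  rintro ⟨N, hN⟩
  obtain ⟨r, hr, hr'⟩ := h1 N
  exact not_le_of_gt hr (hN hr')

end

end TwoChoice

theorem mainTheorem1
    {Ω : Type*} [MeasurableSpace Ω] (μ : Measure Ω) [IsProbabilityMeasure μ]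
    (Z W : Ω → ℕ+) (Zs Ws : ℕ+ → Ω → ℕ+)
    -- `Z` and `W` are i.i.d.
    (hZW_indep : IndepFun Z W μ)
    (hW : IdentDistrib W Z μ μ)
    -- `(Z_n)` and `(W_n)` are jointly independent copies of `Z`
    (h_indep : iIndepFun (Sum.elim Zs Ws) μ)
    (hZs : ∀ n, IdentDistrib (Zs n) Z μ μ)
    (hWs : ∀ n, IdentDistrib (Ws n) Z μ μ)
    -- aperiodicity and the moderate-tail regime
    (h_aper : TwoChoice.AperiodicLaw μ Z)
    (hZ_mean : ∫⁻ ω, ((Z ω : ℕ) : ℝ≥0∞) ∂μ = ∞)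
    (h_min_mean : ∫⁻ ω, ((min (Z ω : ℕ) (W ω : ℕ) : ℕ) : ℝ≥0∞) ∂μ < ∞) :
    ∀ᵐ ω ∂μ, Tendsto
      (fun n : ℕ => TwoChoice.numLeaves (fun k => Zs k ω) (fun k => Ws k ω) (n : ℤ))
      atTop atTop := by
  have hZae : AEMeasurable Z μ := hW.aemeasurable_snd
  have hWae : AEMeasurable W μ := hW.aemeasurable_fst
  have hcoe : Measurable fun k : ℕ+ => (k : ℕ) := measurable_from_top
  have hlaw : ∀ A : Set ℕ+, μ.map Z A = μ (Z ⁻¹' A) := fun A =>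
    Measure.map_apply_of_aemeasurable hZae MeasurableSet.of_discrete
  have hZmk : ∀ k, Zs k =ᵐ[μ] (hZs k).aemeasurable_fst.mk := fun k =>
    (hZs k).aemeasurable_fst.ae_eq_mk
  have hWmk : ∀ k, Ws k =ᵐ[μ] (hWs k).aemeasurable_fst.mk := fun k =>
    (hWs k).aemeasurable_fst.ae_eq_mk
  -- The edge lengths are only almost everywhere measurable, so measurable versions replace them.
  have hmain := TwoChoice.ae_tendsto_numLeaves (μ := μ) (ν := μ.map Z)
    (Zs := fun k => (hZs k).aemeasurable_fst.mk) (Ws := fun k => (hWs k).aemeasurable_fst.mk)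
    (fun k => (hZs k).aemeasurable_fst.measurable_mk)
    (fun k => (hWs k).aemeasurable_fst.measurable_mk)
    (h_indep.congr (by
      rintro (k | k)
      exacts [hZmk k, hWmk k]))
    (fun k A => by
      rw [hlaw, ← (hZs k).measure_mem_eq MeasurableSet.of_discrete]
      exact measure_congr ((hZmk k).symm.preimage A))
    (fun k A => by
      rw [hlaw, ← (hWs k).measure_mem_eq MeasurableSet.of_discrete]
      exact measure_congr ((hWmk k).symm.preimage A))
    (by
      simp only [hlaw]
      exact h_aper)
    (by
      rw [← hZ_mean]
      exact (tsum_congr fun j => hlaw _).trans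
        (TwoChoice.lintegral_natCast_eq_tsum_measure_lt (hcoe.comp_aemeasurable hZae)).symm)
    (by
      have htail := TwoChoice.lintegral_natCast_eq_tsum_measure_lt
        ((hcoe.comp_aemeasurable hZae).min (hcoe.comp_aemeasurable hWae))
      -- `P(min(Z, W) > j) = P(Z > j)²`.
      convert (htail.symm.trans_lt h_min_mean).ne using 3 with j
      rw [hlaw, sq]
      nth_rewrite 2 [← hW.measure_mem_eq MeasurableSet.of_discrete]
      rw [← hZW_indep.measure_inter_preimage_eq_mul _ _ MeasurableSet.of_discrete
        MeasurableSet.of_discrete]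
      congr 1
      ext ω
      exact (lt_min_iff (a := j) (b := (Z ω : ℕ)) (c := (W ω : ℕ))).symm)
  filter_upwards [hmain, ae_all_iff.2 hZmk, ae_all_iff.2 hWmk] with ω hω hzω hwω
  simpa only [hzω, hwω] using hω
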